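/- Let $n\ge 1$, let $\Omega\subset\mathbb{R}^n$ be a bounded domain (non-empty, open, connected) with boundary of class $C^{1,\alpha}$ for some $\alpha\in(0,1]$, and let $p\in C(\overline{\Omega})$ be real-valued with $p_-:=\inf_{x\in\Omega}p(x)>1$. For a measurable function $v$ on $\Omega$ with values in $\mathbb{R}$ or $\mathbb{R}^n$ (functions equal almost everywhere are identified, $|\cdot|$ is the Euclidean norm) put $\varrho_p(v)=\int_\Omega |v(x)|^{p(x)}\,dx\in[0,\infty]$, and let $L^{p}(\Omega)$ be the space of those $v$ with $\varrho_p(av)\to 0$ as $a\to 0$. Let $W^{1,p}(\Omega)$ be the space of real-valued $u\in L^{p}(\Omega)$ whose weak first-order derivatives exist and belong to $L^{p}(\Omega)$, with the Luxemburg norm $$\|u\|=\inf\Big\{\lambda>0:\ \varrho_p\big(\tfrac{u}{\lambda}\big)+\varrho_p\big(\tfrac{|\nabla u|}{\lambda}\big)\le 1\Big\},$$ let $W^{1,p}_0(\Omega)$ be the closure of $C_0^\infty(\Omega)$ in $W^{1,p}(\Omega)$ for this norm, and let $(W^{1,p}_0(\Omega))^*$ be its topological dual. Then for every $f\in (W^{1,p}_0(\Omega))^*$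 and every $\varphi\in W^{1,p}(\Omega)$ the functional $$F:W^{1,p}_0(\Omega)\to\mathbb{R},\qquad F(u)=\int_\Omega\frac{|\nabla(\varphi-u)(x)|^{p(x)}}{p(x)}\,dx-f(u),$$ is well defined (the integral is finite for every $u\in W^{1,p}_0(\Omega)$) and bounded below. -/

import Mathlib

open MeasureTheory Set Filter Topology TopologicalSpace
open scoped Pointwise ENNReal NNReal Distributions InnerProductSpace

noncomputable section

/-! ### Convex modulars and Luxemburg norms -/

/-- A convex modular on a real vector space. -/
structure ConvexModular (X : Type*) [AddCommGroup X] [Module ℝ X] where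
  toFun : X → ℝ≥0∞
  eq_zero_iff : ∀ x, toFun x = 0 ↔ x = 0
  map_smul_of_abs_eq_one : ∀ (c : ℝ) (x : X), |c| = 1 → toFun (c • x) = toFun x
  convex : ∀ (a : ℝ) (x y : X), 0 ≤ a → a ≤ 1 →
    toFun (a • x + (1 - a) • y) ≤ ENNReal.ofReal a * toFun x + ENNReal.ofReal (1 - a) * toFun y

namespace ConvexModular

variable {X : Type*} [AddCommGroup X] [Module ℝ X] (ρ : ConvexModular X)

theorem map_smul_le (c : ℝ) (x : X) (hc : |c| ≤ 1) :
    ρ.toFun (c • x) ≤ ENNReal.ofReal |c| * ρ.toFun x := by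
  have key : ∀ a : ℝ, 0 ≤ a → a ≤ 1 → ∀ y, ρ.toFun (a • y) ≤ ENNReal.ofReal a * ρ.toFun y := by
    intro a h0 h1 y
    have := ρ.convex a y 0 h0 h1
    simpa [(ρ.eq_zero_iff 0).2 rfl] using this
  rcases le_total 0 c with h | h
  · rw [abs_of_nonneg h] at hc ⊢
    exact key c h hc x
  · rw [abs_of_nonpos h] at hc ⊢
    have h1 := ρ.map_smul_of_abs_eq_one (-1) (c • x) (by simp)
    rw [← h1, smul_smul]
    simpa using key (-c) (by linarith) hc x

/-- The modular space `{x | ρ (a x) → 0 as a → 0}`. -/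
def modularSpace : Submodule ℝ X where
  carrier := {x | Tendsto (fun a : ℝ => ρ.toFun (a • x)) (𝓝 0) (𝓝 0)}
  zero_mem' := by simp [(ρ.eq_zero_iff 0).2 rfl]
  add_mem' := by
    intro x y hx hy
    simp only [mem_ofPred_eq] at *
    have h2 : Tendsto (fun a : ℝ => 2 * a) (𝓝 0) (𝓝 0) := by
      have : Continuous (fun a : ℝ => 2 * a) := by fun_prop
      simpa using this.tendsto 0
    have hs := (hx.comp h2).add (hy.comp h2)
    rw [add_zero] at hs
    refine tendsto_of_tendsto_of_tendsto_of_le_of_le tendsto_const_nhds hs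
      (fun _ => zero_le) (fun a => ?_)
    have := ρ.convex (1 / 2) ((2 * a) • x) ((2 * a) • y) (by norm_num) (by norm_num)
    have e : (1 / 2 : ℝ) • (2 * a) • x + (1 - 1 / 2 : ℝ) • (2 * a) • y = a • (x + y) := by
      rw [smul_smul, smul_smul, smul_add]; congr 2 <;> ring
    rw [e] at this
    refine this.trans (add_le_add ?_ ?_)
    · exact mul_le_of_le_one_left zero_le (by rw [ENNReal.ofReal_le_one]; norm_num)
    · exact mul_le_of_le_one_left zero_le (by rw [ENNReal.ofReal_le_one]; norm_num)
  smul_mem' := by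
    intro c x hx
    simp only [mem_ofPred_eq] at *
    have h2 : Tendsto (fun a : ℝ => a * c) (𝓝 0) (𝓝 0) := by
      have : Continuous (fun a : ℝ => a * c) := by fun_prop
      simpa using this.tendsto 0
    simpa [Function.comp_def, smul_smul] using hx.comp h2

/-- The Luxemburg norm `inf {a > 0 | ρ (x / a) ≤ 1}`. -/
def luxemburgNorm (x : X) : ℝ := sInf {a : ℝ | 0 < a ∧ ρ.toFun (a⁻¹ • x) ≤ 1}

theorem bddBelow_lux (x : X) : BddBelow {a : ℝ | 0 < a ∧ ρ.toFun (a⁻¹ • x) ≤ 1} :=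
  ⟨0, fun _ h => h.1.le⟩

theorem nonempty_lux {x : X} (hx : x ∈ ρ.modularSpace) :
    {a : ℝ | 0 < a ∧ ρ.toFun (a⁻¹ • x) ≤ 1}.Nonempty := by
  have h1 : ∀ᶠ a : ℝ in 𝓝[>] 0, ρ.toFun (a • x) ≤ 1 :=
    (Tendsto.mono_left hx nhdsWithin_le_nhds).eventually_le_const zero_lt_one
  obtain ⟨a, ha, ha0⟩ := (h1.and self_mem_nhdsWithin).exists
  exact ⟨a⁻¹, inv_pos.2 ha0, by simpa using ha⟩

theorem lux_nonneg (x : X) : 0 ≤ ρ.luxemburgNorm x :=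
  Real.sInf_nonneg fun _ h => h.1.le

theorem lux_smul (c : ℝ) (x : X) : ρ.luxemburgNorm (c • x) = |c| * ρ.luxemburgNorm x := by
  rcases eq_or_ne c 0 with rfl | hc
  · have : {a : ℝ | 0 < a ∧ ρ.toFun (a⁻¹ • ((0 : ℝ) • x)) ≤ 1} = Ioi 0 := by
      ext a; simp [(ρ.eq_zero_iff 0).2 rfl]
    simp only [luxemburgNorm, this, csInf_Ioi, abs_zero, zero_mul]
  · have hc' : 0 < |c| := abs_pos.2 hc
    have : {a : ℝ | 0 < a ∧ ρ.toFun (a⁻¹ • (c • x)) ≤ 1}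
        = |c| • {a : ℝ | 0 < a ∧ ρ.toFun (a⁻¹ • x) ≤ 1} := by
      ext a
      rw [mem_smul_set_iff_inv_smul_mem₀ hc'.ne']
      simp only [mem_ofPred_eq, smul_eq_mul, mul_inv, inv_inv]
      have e : ρ.toFun (a⁻¹ • c • x) = ρ.toFun ((|c| * a⁻¹) • x) := by
        have := ρ.map_smul_of_abs_eq_one (c / |c|) ((|c| * a⁻¹) • x)
          (by rw [abs_div, abs_abs, div_self hc'.ne'])
        rw [← this, smul_smul, smul_smul]
        congr 2
        field_simp
      rw [e]
      refine and_congr_left fun _ => ?_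
      constructor
      · intro h; positivity
      · intro h
        exact (pos_iff_pos_of_mul_pos h).1 (inv_pos.2 hc')
    rw [luxemburgNorm, this, Real.sInf_smul_of_nonneg hc'.le]
    rfl

theorem lux_add {x y : X} (hx : x ∈ ρ.modularSpace) (hy : y ∈ ρ.modularSpace) :
    ρ.luxemburgNorm (x + y) ≤ ρ.luxemburgNorm x + ρ.luxemburgNorm y := by
  refine le_of_forall_pos_le_add fun ε hε => ?_
  obtain ⟨a, ⟨ha0, ha⟩, ha'⟩ := exists_lt_of_csInf_lt (ρ.nonempty_lux hx)
    (show ρ.luxemburgNorm x < ρ.luxemburgNorm x + ε / 2 by linarith)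
  obtain ⟨b, ⟨hb0, hb⟩, hb'⟩ := exists_lt_of_csInf_lt (ρ.nonempty_lux hy)
    (show ρ.luxemburgNorm y < ρ.luxemburgNorm y + ε / 2 by linarith)
  have h1 : ρ.luxemburgNorm (x + y) ≤ a + b := by
    refine csInf_le (ρ.bddBelow_lux _) ⟨by positivity, ?_⟩
    have ht : a / (a + b) ≤ 1 := by rw [div_le_one (by positivity)]; linarith
    have ht0 : 0 ≤ a / (a + b) := by positivity
    have := ρ.convex (a / (a + b)) (a⁻¹ • x) (b⁻¹ • y) ht0 ht
    have e : (a / (a + b)) • a⁻¹ • x + (1 - a / (a + b)) • b⁻¹ • y = (a + b)⁻¹ • (x + y) := by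
      have hab : a + b ≠ 0 := by positivity
      rw [smul_smul, smul_smul, smul_add]
      congr 2 <;> field_simp
      ring
    rw [e] at this
    refine this.trans ?_
    calc _ ≤ ENNReal.ofReal (a / (a + b)) * 1 + ENNReal.ofReal (1 - a / (a + b)) * 1 := by gcongr
      _ = 1 := by
        rw [mul_one, mul_one, ← ENNReal.ofReal_add ht0 (by linarith)]; simp
  linarith

theorem eq_zero_of_lux {x : X} (hx : x ∈ ρ.modularSpace) (h : ρ.luxemburgNorm x = 0) :
    x = 0 := by
  rw [← ρ.eq_zero_iff]
  by_contra hne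
  obtain ⟨δ, hδ0, hδ⟩ : ∃ δ : ℝ≥0, 0 < δ ∧ (δ : ℝ≥0∞) < ρ.toFun x :=
    ENNReal.lt_iff_exists_nnreal_btwn.1 (pos_iff_ne_zero.2 hne) |>.imp
      fun r hr => ⟨by exact_mod_cast hr.1, hr.2⟩
  have hpos : 0 < min (δ : ℝ) 1 := lt_min (by exact_mod_cast hδ0) one_pos
  obtain ⟨a, ⟨ha0, ha⟩, ha'⟩ := exists_lt_of_csInf_lt (ρ.nonempty_lux hx)
    (show ρ.luxemburgNorm x < min (δ : ℝ) 1 by rw [h]; exact hpos)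
  have h1 : a ≤ 1 := (ha'.trans_le (min_le_right _ _)).le
  have h2 := ρ.map_smul_le a (a⁻¹ • x) (by rwa [abs_of_pos ha0])
  rw [smul_inv_smul₀ ha0.ne', abs_of_pos ha0] at h2
  have h3 : ρ.toFun x ≤ δ := by
    refine h2.trans ((mul_le_of_le_one_right zero_le ha).trans ?_)
    rw [← ENNReal.ofReal_coe_nnreal]
    exact ENNReal.ofReal_le_ofReal (ha'.trans_le (min_le_left _ _)).le
  exact absurd hδ (not_lt.2 h3)

end ConvexModular

/-! ### Variable exponent Lebesgue and Sobolev spaces -/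

/-- A continuous variable exponent on the closure of `Ω` with infimum `p₋ > 1`. -/
structure VarExponent {n : ℕ} (Ω : Opens (EuclideanSpace ℝ (Fin n))) where
  toFun : EuclideanSpace ℝ (Fin n) → ℝ
  continuousOn : ContinuousOn toFun (closure (Ω : Set (EuclideanSpace ℝ (Fin n))))
  one_lt_sInf : 1 < sInf (toFun '' (Ω : Set (EuclideanSpace ℝ (Fin n))))

section VariableExponent

variable {n : ℕ} {Ω : Opens (EuclideanSpace ℝ (Fin n))}

/-- `M(Ω; V)`: measurable functions on `Ω` with values in `V`, up to equality a.e. -/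
abbrev MeasFun (Ω : Opens (EuclideanSpace ℝ (Fin n))) (V : Type*) [NormedAddCommGroup V] :
    Type _ :=
  EuclideanSpace ℝ (Fin n) →ₘ[volume.restrict (Ω : Set (EuclideanSpace ℝ (Fin n)))] V

namespace VarExponent

variable (p : VarExponent Ω)

theorem one_lt {x : EuclideanSpace ℝ (Fin n)} (hx : x ∈ Ω) : 1 < p.toFun x := by
  refine p.one_lt_sInf.trans_le (csInf_le ?_ (mem_image_of_mem _ hx))
  by_contra h
  have := p.one_lt_sInf
  rw [Real.sInf_of_not_bddBelow h] at this
  linarith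

theorem ae_one_lt :
    ∀ᵐ x ∂(volume.restrict (Ω : Set (EuclideanSpace ℝ (Fin n)))), 1 < p.toFun x :=
  (ae_restrict_iff' Ω.isOpen.measurableSet).2 (ae_of_all _ fun _ hx => p.one_lt hx)

theorem aemeasurable :
    AEMeasurable p.toFun (volume.restrict (Ω : Set (EuclideanSpace ℝ (Fin n)))) :=
  (p.continuousOn.mono subset_closure).aemeasurable Ω.isOpen.measurableSet

theorem aemeasurable_pow {V : Type*} [NormedAddCommGroup V] (u : MeasFun Ω V) :
    AEMeasurable (fun x => ‖u x‖ₑ ^ p.toFun x)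
      (volume.restrict (Ω : Set (EuclideanSpace ℝ (Fin n)))) :=
  u.aestronglyMeasurable.enorm.pow p.aemeasurable

variable (V : Type*) [NormedAddCommGroup V] [NormedSpace ℝ V]

/-- The modular `∫_Ω |u(x)|^{p(x)} dx`, for functions with values in `V`. -/
def lebesgueModular : ConvexModular (MeasFun Ω V) where
  toFun u := ∫⁻ x in (Ω : Set (EuclideanSpace ℝ (Fin n))), ‖u x‖ₑ ^ p.toFun x
  eq_zero_iff u := by
    rw [lintegral_eq_zero_iff' (p.aemeasurable_pow u)]
    constructor
    · intro h
      refine AEEqFun.ext ?_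
      filter_upwards [h, p.ae_one_lt, AEEqFun.coeFn_zero (β := V)] with x hx hp h0
      rw [h0]
      simpa [ENNReal.rpow_eq_zero_iff, (by linarith : 0 < p.toFun x),
        (by linarith : ¬ p.toFun x < 0)] using hx
    · rintro rfl
      filter_upwards [p.ae_one_lt, AEEqFun.coeFn_zero (β := V)] with x hp h0
      rw [h0]
      simp [(by linarith : 0 < p.toFun x)]
  map_smul_of_abs_eq_one c u hc := by
    refine lintegral_congr_ae ?_
    filter_upwards [AEEqFun.coeFn_smul c u] with x hx
    have : ‖c‖ₑ = 1 := by
      rw [← ofReal_norm, Real.norm_eq_abs, hc, ENNReal.ofReal_one]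
    simp [hx, enorm_smul, this]
  convex a u v h0 h1 := by
    rw [← lintegral_const_mul' _ _ ENNReal.ofReal_ne_top,
      ← lintegral_const_mul' _ _ ENNReal.ofReal_ne_top,
      ← lintegral_add_left' ((p.aemeasurable_pow u).const_mul _)]
    refine lintegral_mono_ae ?_
    filter_upwards [AEEqFun.coeFn_smul a u, AEEqFun.coeFn_smul (1 - a) v,
      AEEqFun.coeFn_add (a • u) ((1 - a) • v), p.ae_one_lt] with x hu hv huv hp
    rw [huv, Pi.add_apply, hu, hv]
    have hw : ENNReal.ofReal a + ENNReal.ofReal (1 - a) = 1 := by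
      rw [← ENNReal.ofReal_add h0 (by linarith)]; simp
    refine le_trans ?_ (ENNReal.rpow_arith_mean_le_arith_mean2_rpow _ _ _ _ hw hp.le)
    gcongr
    refine (enorm_add_le _ _).trans ?_
    simp only [Pi.smul_apply, enorm_smul]
    rw [Real.enorm_of_nonneg h0, Real.enorm_of_nonneg (by linarith : 0 ≤ 1 - a)]

/-- The variable exponent Lebesgue space `L^{p(·)}(Ω; V)`. -/
def lebesgueSpace : Submodule ℝ (MeasFun Ω V) := (p.lebesgueModular V).modularSpace

end VarExponent

/-- `G` is the weak gradient of `u` in `Ω`. -/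
def HasWeakGradient (u : MeasFun Ω ℝ) (G : MeasFun Ω (EuclideanSpace ℝ (Fin n))) : Prop :=
  LocallyIntegrableOn u Ω volume ∧ LocallyIntegrableOn G Ω volume ∧
    ∀ (η : 𝓓(Ω, ℝ)) (i : Fin n),
      ∫ x in (Ω : Set (EuclideanSpace ℝ (Fin n))),
          u x * fderiv ℝ η x (EuclideanSpace.single i 1) =
        - ∫ x in (Ω : Set (EuclideanSpace ℝ (Fin n))), G x i * η x

theorem integrableOn_mul_of_compactSupport {h g : EuclideanSpace ℝ (Fin n) → ℝ}
    (hh : LocallyIntegrableOn h Ω volume) (hg : Continuous g) (hc : HasCompactSupport g)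
    (hs : tsupport g ⊆ Ω) :
    IntegrableOn (fun x => h x * g x) (Ω : Set (EuclideanSpace ℝ (Fin n))) := by
  have h1 : IntegrableOn h (tsupport g) := hh.integrableOn_compact_subset hs hc
  have h2 : IntegrableOn (fun x => h x * g x) (tsupport g) :=
    h1.mul_continuousOn hg.continuousOn hc
  have h3 : Integrable (fun x => h x * g x) := by
    rw [← integrableOn_iff_integrable_of_support_subset (s := tsupport g)]
    · exact h2
    · intro x hx
      apply subset_tsupport
      simp only [Function.mem_support] at hx ⊢
      exact right_ne_zero_of_mul hx
  exact h3.integrableOn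

theorem locallyIntegrableOn_congr {V : Type*} [NormedAddCommGroup V]
    {f g : EuclideanSpace ℝ (Fin n) → V}
    (hf : LocallyIntegrableOn f Ω volume)
    (hfg : f =ᵐ[volume.restrict (Ω : Set (EuclideanSpace ℝ (Fin n)))] g) :
    LocallyIntegrableOn g Ω volume := by
  rw [locallyIntegrableOn_iff Ω.isOpen.isLocallyClosed] at hf ⊢
  · intro K hK hKc
    exact (hf K hK hKc).congr (ae_mono (Measure.restrict_mono hK le_rfl) hfg)

theorem locallyIntegrableOn_coord {G : EuclideanSpace ℝ (Fin n) → EuclideanSpace ℝ (Fin n)}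
    (hG : LocallyIntegrableOn G Ω volume) (i : Fin n) :
    LocallyIntegrableOn (fun x => G x i) Ω volume := by
  intro x hx
  obtain ⟨s, hs, hi⟩ := hG x hx
  exact ⟨s, hs, (EuclideanSpace.proj (𝕜 := ℝ) i).integrable_comp hi⟩

namespace HasWeakGradient

variable {u v : MeasFun Ω ℝ} {G H : MeasFun Ω (EuclideanSpace ℝ (Fin n))}

theorem deriv_props (η : 𝓓(Ω, ℝ)) (w : EuclideanSpace ℝ (Fin n)) :
    Continuous (fun x => fderiv ℝ η x w) ∧ HasCompactSupport (fun x => fderiv ℝ η x w) ∧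
      tsupport (fun x => fderiv ℝ η x w) ⊆ Ω := by
  have hsub : tsupport (fun x => fderiv ℝ η x w) ⊆ tsupport η := by
    refine closure_minimal ?_ (isClosed_tsupport _)
    intro x hx
    refine support_fderiv_subset ℝ (f := η) ?_
    simp only [Function.mem_support] at hx ⊢
    intro h
    exact hx (by rw [h]; rfl)
  refine ⟨?_, ?_, hsub.trans η.tsupport_subset⟩
  · exact (η.contDiff.continuous_fderiv (by simp)).clm_apply continuous_const
  · exact η.hasCompactSupport.of_isClosed_subset (isClosed_tsupport _) hsub

theorem add (hu : HasWeakGradient u G) (hv : HasWeakGradient v H) :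
    HasWeakGradient (u + v) (G + H) := by
  refine ⟨locallyIntegrableOn_congr (hu.1.add hv.1) (AEEqFun.coeFn_add u v).symm,
    locallyIntegrableOn_congr (hu.2.1.add hv.2.1) (AEEqFun.coeFn_add G H).symm, ?_⟩
  intro η i
  obtain ⟨h1, h2, h3⟩ := deriv_props η (EuclideanSpace.single i 1)
  have e1 := integral_add (integrableOn_mul_of_compactSupport hu.1 h1 h2 h3)
    (integrableOn_mul_of_compactSupport hv.1 h1 h2 h3)
  have e2 := integral_add
    (integrableOn_mul_of_compactSupport (locallyIntegrableOn_coord hu.2.1 i) η.continuous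
      η.hasCompactSupport η.tsupport_subset)
    (integrableOn_mul_of_compactSupport (locallyIntegrableOn_coord hv.2.1 i) η.continuous
      η.hasCompactSupport η.tsupport_subset)
  rw [hu.2.2 η i, hv.2.2 η i, ← neg_add, ← e2] at e1
  convert e1 using 1
  · refine integral_congr_ae ?_
    filter_upwards [AEEqFun.coeFn_add u v] with x hx
    rw [hx, Pi.add_apply, add_mul]
  · congr 1
    refine integral_congr_ae ?_
    filter_upwards [AEEqFun.coeFn_add G H] with x hx
    rw [hx, Pi.add_apply, PiLp.add_apply, add_mul]

theorem smul (c : ℝ) (hu : HasWeakGradient u G) : HasWeakGradient (c • u) (c • G) := by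
  refine ⟨locallyIntegrableOn_congr (hu.1.smul c) (AEEqFun.coeFn_smul c u).symm,
    locallyIntegrableOn_congr (hu.2.1.smul c) (AEEqFun.coeFn_smul c G).symm, ?_⟩
  intro η i
  have e := congrArg (c * ·) (hu.2.2 η i)
  simp only [mul_neg, ← integral_const_mul] at e
  convert e using 1
  · refine integral_congr_ae ?_
    filter_upwards [AEEqFun.coeFn_smul c u] with x hx
    rw [hx, Pi.smul_apply, smul_eq_mul, mul_assoc]
  · congr 1
    refine integral_congr_ae ?_
    filter_upwards [AEEqFun.coeFn_smul c G] with x hx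
    rw [hx, Pi.smul_apply, PiLp.smul_apply, smul_eq_mul, mul_assoc]

theorem zero : HasWeakGradient (0 : MeasFun Ω ℝ) 0 := by
  refine ⟨locallyIntegrableOn_congr locallyIntegrableOn_zero AEEqFun.coeFn_zero.symm,
    locallyIntegrableOn_congr locallyIntegrableOn_zero AEEqFun.coeFn_zero.symm, ?_⟩
  intro η i
  have h1 : ∫ x in (Ω : Set (EuclideanSpace ℝ (Fin n))),
      (0 : MeasFun Ω ℝ) x * fderiv ℝ η x (EuclideanSpace.single i 1) = 0 := by
    refine integral_eq_zero_of_ae ?_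
    filter_upwards [AEEqFun.coeFn_zero (β := ℝ)] with x hx
    rw [hx]; simp
  have h2 : ∫ x in (Ω : Set (EuclideanSpace ℝ (Fin n))),
      (0 : MeasFun Ω (EuclideanSpace ℝ (Fin n))) x i * η x = 0 := by
    refine integral_eq_zero_of_ae ?_
    filter_upwards [AEEqFun.coeFn_zero (β := EuclideanSpace ℝ (Fin n))] with x hx
    rw [hx]; simp
  rw [h1, h2, neg_zero]

/-- Weak gradients are unique. -/
theorem unique (hG : HasWeakGradient u G) (hH : HasWeakGradient u H) : G = H := by
  have key : ∀ i : Fin n, ∀ᵐ x ∂(volume : Measure (EuclideanSpace ℝ (Fin n))),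
      x ∈ (Ω : Set (EuclideanSpace ℝ (Fin n))) → G x i - H x i = 0 := by
    intro i
    refine IsOpen.ae_eq_zero_of_integral_contDiff_smul_eq_zero Ω.isOpen
      ((locallyIntegrableOn_coord hG.2.1 i).sub (locallyIntegrableOn_coord hH.2.1 i)) ?_
    intro g hg hgc hgs
    let η : 𝓓(Ω, ℝ) := ⟨g, hg, hgc, hgs⟩
    have e := (hG.2.2 η i).symm.trans (hH.2.2 η i)
    rw [neg_inj] at e
    have iG := integrableOn_mul_of_compactSupport (locallyIntegrableOn_coord hG.2.1 i)
      hg.continuous hgc hgs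
    have iH := integrableOn_mul_of_compactSupport (locallyIntegrableOn_coord hH.2.1 i)
      hg.continuous hgc hgs
    have e' : ∫ x in (Ω : Set (EuclideanSpace ℝ (Fin n))), (G x i * g x - H x i * g x) = 0 := by
      rw [integral_sub iG iH, sub_eq_zero]
      exact e
    rw [← setIntegral_eq_integral_of_forall_compl_eq_zero
      (s := (Ω : Set (EuclideanSpace ℝ (Fin n)))), ← e']
    · refine integral_congr_ae (ae_of_all _ fun x => ?_)
      simp only [smul_eq_mul]
      ring
    · intro x hx
      rw [image_eq_zero_of_notMem_tsupport (fun h => hx (hgs h)), zero_smul]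
  refine AEEqFun.ext ?_
  have := (ae_restrict_iff' Ω.isOpen.measurableSet).2
    ((ae_all_iff.2 key).mono fun x hx hxΩ i => hx i hxΩ)
  filter_upwards [this] with x hx
  ext i
  exact sub_eq_zero.1 (hx i)

end HasWeakGradient

namespace VarExponent

variable (p : VarExponent Ω)

/-- `W^{1,p(·)}(Ω)`, as a subspace of the measurable functions: `u` and its weak first-order
derivatives (here collected in the vector field `G`) lie in `L^{p(·)}`. -/
def sobolevSubmodule : Submodule ℝ (MeasFun Ω ℝ) where
  carrier := {u | u ∈ p.lebesgueSpace ℝ ∧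
    ∃ G ∈ p.lebesgueSpace (EuclideanSpace ℝ (Fin n)), HasWeakGradient u G}
  zero_mem' := ⟨Submodule.zero_mem _, 0, Submodule.zero_mem _, HasWeakGradient.zero⟩
  add_mem' := by
    rintro u v ⟨hu, G, hG, hw⟩ ⟨hv, H, hH, hw'⟩
    exact ⟨Submodule.add_mem _ hu hv, _, Submodule.add_mem _ hG hH, hw.add hw'⟩
  smul_mem' := by
    rintro c u ⟨hu, G, hG, hw⟩
    exact ⟨Submodule.smul_mem _ c hu, _, Submodule.smul_mem _ c hG, hw.smul c⟩

/-- The variable exponent Sobolev space `W^{1,p(·)}(Ω)`. -/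
def SobolevSpace : Type := ↥p.sobolevSubmodule

instance : AddCommGroup p.SobolevSpace := inferInstanceAs (AddCommGroup ↥p.sobolevSubmodule)

instance : Module ℝ p.SobolevSpace := inferInstanceAs (Module ℝ ↥p.sobolevSubmodule)

variable {p}

/-- The function underlying an element of `W^{1,p(·)}(Ω)`. -/
def SobolevSpace.toMeasFun : p.SobolevSpace →ₗ[ℝ] MeasFun Ω ℝ := p.sobolevSubmodule.subtype

theorem SobolevSpace.exists_gradient (u : p.SobolevSpace) :
    ∃ G ∈ p.lebesgueSpace (EuclideanSpace ℝ (Fin n)), HasWeakGradient u.toMeasFun G :=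
  u.2.2

theorem SobolevSpace.choose_spec' (u : p.SobolevSpace) :
    HasWeakGradient u.toMeasFun u.exists_gradient.choose :=
  u.exists_gradient.choose_spec.2

/-- The weak gradient `∇u` of `u ∈ W^{1,p(·)}(Ω)`. -/
def SobolevSpace.grad : p.SobolevSpace →ₗ[ℝ] MeasFun Ω (EuclideanSpace ℝ (Fin n)) where
  toFun u := u.exists_gradient.choose
  map_add' u v := (SobolevSpace.choose_spec' (u + v)).unique
    ((SobolevSpace.choose_spec' u).add (SobolevSpace.choose_spec' v))
  map_smul' c u := (SobolevSpace.choose_spec' (c • u)).unique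
    ((SobolevSpace.choose_spec' u).smul c)

variable (p)

/-- The modular `ϱ_p(u) + ϱ_p(|∇u|)` on `W^{1,p(·)}(Ω)`, with `|·|` the Euclidean norm. -/
def sobolevModular : ConvexModular p.SobolevSpace where
  toFun u := (p.lebesgueModular ℝ).toFun u.toMeasFun +
    (p.lebesgueModular (EuclideanSpace ℝ (Fin n))).toFun u.grad
  eq_zero_iff u := by
    rw [add_eq_zero, ConvexModular.eq_zero_iff, ConvexModular.eq_zero_iff]
    constructor
    · intro h
      exact Subtype.ext h.1
    · rintro rfl
      simp
  map_smul_of_abs_eq_one c u hc := by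
    rw [map_smul, map_smul, ConvexModular.map_smul_of_abs_eq_one _ _ _ hc,
      ConvexModular.map_smul_of_abs_eq_one _ _ _ hc]
  convex a u v h0 h1 := by
    simp only [map_add, map_smul]
    refine (add_le_add (ConvexModular.convex _ a _ _ h0 h1)
      (ConvexModular.convex _ a _ _ h0 h1)).trans (le_of_eq ?_)
    ring

theorem mem_modularSpace (u : p.SobolevSpace) : u ∈ p.sobolevModular.modularSpace := by
  have h1 : Tendsto (fun a : ℝ => (p.lebesgueModular ℝ).toFun (a • u.toMeasFun)) (𝓝 0) (𝓝 0) :=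
    u.2.1
  have h2 : Tendsto (fun a : ℝ =>
      (p.lebesgueModular (EuclideanSpace ℝ (Fin n))).toFun (a • u.grad)) (𝓝 0) (𝓝 0) :=
    u.exists_gradient.choose_spec.1
  have := h1.add h2
  rw [add_zero] at this
  change Tendsto (fun a : ℝ => p.sobolevModular.toFun (a • u)) (𝓝 0) (𝓝 0)
  simpa [sobolevModular] using this

/-- `W^{1,p(·)}(Ω)` carries the Luxemburg norm of its modular. -/
instance : Norm p.SobolevSpace := ⟨p.sobolevModular.luxemburgNorm⟩

theorem sobolevSpace_core : NormedSpace.Core ℝ p.SobolevSpace where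
  norm_nonneg u := p.sobolevModular.lux_nonneg u
  norm_smul c u := p.sobolevModular.lux_smul c u
  norm_triangle u v := p.sobolevModular.lux_add (p.mem_modularSpace u) (p.mem_modularSpace v)
  norm_eq_zero_iff u := by
    constructor
    · exact p.sobolevModular.eq_zero_of_lux (p.mem_modularSpace u)
    · rintro rfl
      have := p.sobolevModular.lux_smul 0 0
      rw [zero_smul, abs_zero, zero_mul] at this
      exact this

instance : NormedAddCommGroup p.SobolevSpace := NormedAddCommGroup.ofCore p.sobolevSpace_core

instance : NormedSpace ℝ p.SobolevSpace := NormedSpace.ofCore p.sobolevSpace_core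

/-- The elements of `W^{1,p(·)}(Ω)` given by functions in `C_0^∞(Ω)`. -/
def testSubmodule : Submodule ℝ p.SobolevSpace where
  carrier := {u | ∃ η : 𝓓(Ω, ℝ),
    u.toMeasFun =ᵐ[volume.restrict (Ω : Set (EuclideanSpace ℝ (Fin n)))] η}
  zero_mem' := ⟨0, by
    rw [map_zero]
    exact AEEqFun.coeFn_zero⟩
  add_mem' := by
    rintro u v ⟨η, hη⟩ ⟨ξ, hξ⟩
    refine ⟨η + ξ, ?_⟩
    rw [map_add]
    filter_upwards [AEEqFun.coeFn_add u.toMeasFun v.toMeasFun, hη, hξ] with x h1 h2 h3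
    rw [h1, Pi.add_apply, h2, h3]
    rfl
  smul_mem' := by
    rintro c u ⟨η, hη⟩
    refine ⟨c • η, ?_⟩
    rw [map_smul]
    filter_upwards [AEEqFun.coeFn_smul c u.toMeasFun, hη] with x h1 h2
    rw [h1, Pi.smul_apply, h2]
    rfl

/-- `W_0^{1,p(·)}(Ω)`: the closure of `C_0^∞(Ω)` in `W^{1,p(·)}(Ω)` for the Luxemburg norm. -/
def sobolevZero : Submodule ℝ p.SobolevSpace := p.testSubmodule.topologicalClosure

variable {p}

/-- The integrand `|∇w(x)|^{p(x)} / p(x)` of the Dirichlet integral. -/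
def dirichletIntegrand (w : p.SobolevSpace) (x : EuclideanSpace ℝ (Fin n)) : ℝ :=
  ‖w.grad x‖ ^ p.toFun x / p.toFun x

/-- The functional `F(u) = ∫_Ω |∇(φ - u)|^p / p dx - f(u)` on `W_0^{1,p(·)}(Ω)`. -/
def energy (φ : p.SobolevSpace) (f : StrongDual ℝ ↥p.sobolevZero) (u : ↥p.sobolevZero) : ℝ :=
  (∫ x in (Ω : Set (EuclideanSpace ℝ (Fin n))), dirichletIntegrand (φ - (u : p.SobolevSpace)) x) - f u

end VarExponent

end VariableExponent

/-- `Ω` has a boundary of class `C^{1,α}`: near each boundary point, and after a rotation of the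
axes, `Ω` is the region above the graph of a `C^1` function with `α`-Hölder derivative. Here the
unit vector `ν` is the direction of the last axis, and its orthogonal complement plays the role
of `ℝ^{n-1}`. -/
def HasC1HolderBoundary {n : ℕ} (α : ℝ≥0) (Ω : Set (EuclideanSpace ℝ (Fin n))) : Prop :=
  ∀ x₀ ∈ frontier Ω, ∃ (ν : EuclideanSpace ℝ (Fin n)) (γ : ↥(ℝ ∙ ν)ᗮ → ℝ) (C : ℝ≥0) (r : ℝ),
    ‖ν‖ = 1 ∧ ContDiff ℝ 1 γ ∧ HolderWith C α (fderiv ℝ γ) ∧ 0 < r ∧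
      ∀ x ∈ Metric.ball x₀ r, x ∈ Ω ↔ γ ((ℝ ∙ ν)ᗮ.orthogonalProjectionOnto x) < ⟪ν, x⟫_ℝ

end

/-!
The functional is coercive in the gradient, and the linear term is controlled by the gradient.

The heart of the matter is the Poincaré inequality `‖u‖ ≤ K ‖∇u‖_{p(·)}` on `W_0^{1,p(·)}(Ω)`
(`VarExponent.exists_norm_le_gradNorm`). It suffices to bound `∫ |u|^{p(x)}` uniformly over the
smooth functions `u` with support in `Ω` and `∫ |∇u|^{p(x)} ≤ 1`; scaling, convexity of the modular
and density do the rest. This bound is obtained by raising the exponent gradually: the truncated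
modulars `∫ |u|^{min(p(x), s)}` are bounded for `s = 1` by the classical Poincaré inequality in
`L^1`, and a bound for `s` gives one for `s + 1/(2n)` (`VarExponent.truncatedBound_step`). Indeed,
`p` is continuous, so near each point of the compact set `closure Ω` its oscillation is so small
that the Sobolev inequality with constant exponents, applied to `u` times a cutoff function, covers
the increase; its right-hand side is finite by the bound for `s` and the bound on the gradient.
Functions in `C_0^∞(Ω)` extend by zero, so the Sobolev inequality is only needed on the whole space.

Let `N(w)` be the Luxemburg norm of `∇w`. If `1 ≤ t < N(w)`, then `∫ |∇w / t|^{p(x)} ≥ 1`, hence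
`∫ |∇w|^{p(x)} ≥ t ^ p₋`, so that the Dirichlet integral, whose weight `1 / p` is bounded below by a
positive constant, grows like `N(w) ^ p₋` and thus faster than any linear function of `N(w)`
(`VarExponent.exists_mul_gradNorm_le`). With `w = φ - u`, the term `f u` is at most
`‖f‖ K (N(φ) + N(w))`, and the energy is bounded below.
-/

/-! ### A Sobolev inequality on bounded sets -/

theorem enorm_le_lintegral_enorm_fderiv_of_dim_one {u : EuclideanSpace ℝ (Fin 1) → ℝ}
    (hu : ContDiff ℝ 1 u) (hc : HasCompactSupport u) (x : EuclideanSpace ℝ (Fin 1)) :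
    ‖u x‖ₑ ≤ ∫⁻ y, ‖fderiv ℝ u y‖ₑ := by
  let e : ℝ ≃ₗᵢ[ℝ] EuclideanSpace ℝ (Fin 1) :=
    (stdOrthonormalBasis ℝ ℝ).equiv (EuclideanSpace.basisFun (Fin 1) ℝ) (finCongr (by simp))
  have h1 : ContDiff ℝ 1 (u ∘ e) := hu.comp e.contDiff
  have h2 : HasCompactSupport (u ∘ e) := hc.comp_homeomorph e.toHomeomorph
  have h3 := h2.enorm_le_lintegral_Ici_deriv h1 (e.symm x)
  simp only [Function.comp_apply, LinearIsometryEquiv.apply_symm_apply] at h3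
  refine h3.trans ((setLIntegral_le_lintegral _ _).trans ?_)
  rw [← e.measurePreserving.lintegral_comp_emb e.toHomeomorph.measurableEmbedding]
  refine lintegral_mono fun t => ?_
  have hd : HasDerivAt (u ∘ e) (fderiv ℝ u (e t) (e 1)) t := by
    have h4 : HasDerivAt e (e 1) t := by
      simpa using (e.toContinuousLinearEquiv : ℝ →L[ℝ] EuclideanSpace ℝ (Fin 1)).hasDerivAt (x := t)
    exact ((hu.differentiable one_ne_zero) (e t)).hasFDerivAt.comp_hasDerivAt t h4
  rw [hd.deriv]
  refine ((fderiv ℝ u (e t)).le_opENorm (e 1)).trans ?_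
  simp

/-- The Gagliardo–Nirenberg–Sobolev inequality on a bounded set for every gradient exponent `q ≥ 1`.
Mathlib's version asks for `q < n`; for larger `q` the gradient is measured in a smaller exponent
first, and in dimension one, where no admissible exponent exists, `u` is bounded by the integral of
its derivative. -/
theorem exists_eLpNorm_le_eLpNorm_fderiv {n : ℕ} (hn : 1 ≤ n)
    {s : Set (EuclideanSpace ℝ (Fin n))} (hs : Bornology.IsBounded s) {q r : ℝ≥0}
    (hq : 1 ≤ q) (hqr : q ≤ r) (h : (q : ℝ)⁻¹ - (n : ℝ)⁻¹ ≤ (r : ℝ)⁻¹) :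
    ∃ C : ℝ≥0∞, C ≠ ∞ ∧ ∀ u : EuclideanSpace ℝ (Fin n) → ℝ, ContDiff ℝ 1 u → tsupport u ⊆ s →
      eLpNorm u r ≤ C * eLpNorm (fderiv ℝ u) q := by
  have hvol : volume s ≠ ∞ := hs.measure_lt_top.ne
  have hr : 1 ≤ r := hq.trans hqr
  have lower : ∀ t : ℝ≥0, 1 ≤ t → t ≤ q → ∀ u : EuclideanSpace ℝ (Fin n) → ℝ, ContDiff ℝ 1 u →
      tsupport u ⊆ s → eLpNorm (fderiv ℝ u) t ≤
        volume s ^ (1 / (t : ℝ) - 1 / q) * eLpNorm (fderiv ℝ u) q := by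
    intro t ht htq u hu hus
    have hsupp : Function.support (fun x => ‖fderiv ℝ u x‖) ⊆ s := by
      refine subset_trans ?_ ((support_fderiv_subset ℝ).trans hus)
      intro x hx
      simpa using hx
    have h1 := eLpNorm_le_eLpNorm_mul_rpow_measure_univ (μ := volume.restrict s)
      (ENNReal.coe_le_coe.2 htq)
      ((hu.continuous_fderiv one_ne_zero).norm.aestronglyMeasurable (μ := volume.restrict s))
    rw [eLpNorm_restrict_eq_of_support_subset hsupp,
      eLpNorm_restrict_eq_of_support_subset hsupp, Measure.restrict_apply_univ,
      eLpNorm_norm, eLpNorm_norm] at h1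
    rw [mul_comm]
    simpa using h1
  have hpos : ∀ t : ℝ≥0, 1 ≤ t → t ≤ q → (0 : ℝ) ≤ 1 / (t : ℝ) - 1 / q := by
    intro t ht htq
    have : (0 : ℝ) < t := by exact_mod_cast zero_lt_one.trans_le ht
    rw [sub_nonneg]
    exact one_div_le_one_div_of_le this (by exact_mod_cast htq)
  rcases hn.eq_or_lt with rfl | hn2
  · refine ⟨volume s ^ ((r : ℝ)⁻¹) * volume s ^ (1 / ((1 : ℝ≥0) : ℝ) - 1 / q),
      ENNReal.mul_ne_top (ENNReal.rpow_ne_top_of_nonneg (by positivity) hvol)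
        (ENNReal.rpow_ne_top_of_nonneg (hpos 1 le_rfl hq) hvol), fun u hu hus => ?_⟩
    have hc : HasCompactSupport u :=
      Metric.isCompact_of_isClosed_isBounded (isClosed_tsupport u) (hs.subset hus)
    rw [mul_assoc]
    refine le_trans ?_ (mul_le_mul_right (lower 1 le_rfl hq u hu hus) _)
    rw [← eLpNorm_restrict_eq_of_support_subset ((subset_tsupport u).trans hus),
      ENNReal.coe_one, eLpNorm_one_eq_lintegral_enorm]
    have := eLpNorm_le_of_ae_enorm_bound (p := (r : ℝ≥0∞)) (μ := volume.restrict s) (f := u)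
      (ae_of_all _ (enorm_le_lintegral_enorm_fderiv_of_dim_one hu hc))
    simpa [mul_comm] using this
  · -- `t` is the exponent whose Sobolev conjugate is `r`, or `1` if that exponent is below `1`.
    have hn0 : (0 : ℝ) < n := by exact_mod_cast hn
    have hr0 : (0 : ℝ) < r := by exact_mod_cast zero_lt_one.trans_le hr
    have hq0 : (0 : ℝ) < q := by exact_mod_cast zero_lt_one.trans_le hq
    set t : ℝ≥0 := max 1 ((r⁻¹ + (n : ℝ≥0)⁻¹)⁻¹) with ht
    have hn1 : (1 : ℝ≥0) < n := by exact_mod_cast hn2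
    have hr0' : 0 < r := by exact_mod_cast hr0
    have htn : t < n := by
      refine max_lt hn1 (inv_lt_of_inv_lt₀ (by positivity) ?_)
      exact lt_add_of_pos_left _ (by positivity)
    have htq : t ≤ q := by
      refine max_le hq (inv_le_of_inv_le₀ (by positivity) ?_)
      rw [← NNReal.coe_le_coe]; push_cast; linarith
    have ht1 : 1 ≤ t := le_max_left _ _
    have htr : (t : ℝ)⁻¹ - (n : ℝ)⁻¹ ≤ (r : ℝ)⁻¹ := by
      have : t⁻¹ ≤ r⁻¹ + (n : ℝ≥0)⁻¹ :=
        inv_le_of_inv_le₀ (by positivity) (le_max_right _ _)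
      rw [← NNReal.coe_le_coe] at this; push_cast at this; linarith
    refine ⟨eLpNormLESNormFDerivOfLeConst ℝ volume s t r * volume s ^ (1 / (t : ℝ) - 1 / q),
      ENNReal.mul_ne_top ENNReal.coe_ne_top
        (ENNReal.rpow_ne_top_of_nonneg (hpos t ht1 htq) hvol), fun u hu hus => ?_⟩
    rw [mul_assoc]
    refine le_trans ?_ (mul_le_mul_right (lower t ht1 htq u hu hus) _)
    exact eLpNorm_le_eLpNorm_fderiv_of_le volume hu ((subset_tsupport u).trans hus) ht1
      (by simpa using htn) (by simpa using htr) hs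

/-! ### Integral estimates -/

theorem ENNReal.rpow_le_one_add_rpow (t : ℝ≥0∞) {a b : ℝ} (ha : 0 ≤ a) (hab : a ≤ b) :
    t ^ a ≤ 1 + t ^ b := by
  rcases le_total t 1 with h | h
  · exact (ENNReal.rpow_le_one h ha).trans le_self_add
  · exact (ENNReal.rpow_le_rpow_of_exponent_le h hab).trans le_add_self

theorem setLIntegral_rpow_le_add {X : Type*} [MeasurableSpace X] {μ : Measure X} {A : Set X}
    (hA : MeasurableSet A) {f : X → ℝ≥0∞} {a b : X → ℝ} (ha : ∀ x ∈ A, 0 ≤ a x)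
    (hab : ∀ x ∈ A, a x ≤ b x) :
    ∫⁻ x in A, f x ^ a x ∂μ ≤ μ A + ∫⁻ x in A, f x ^ b x ∂μ := by
  calc ∫⁻ x in A, f x ^ a x ∂μ ≤ ∫⁻ x in A, (1 + f x ^ b x) ∂μ :=
        setLIntegral_mono' hA fun x hx => ENNReal.rpow_le_one_add_rpow _ (ha x hx) (hab x hx)
    _ = _ := by rw [lintegral_add_left measurable_const, setLIntegral_const, one_mul]

theorem enorm_fderiv_of_notMem_tsupport {E : Type*} [NormedAddCommGroup E] [NormedSpace ℝ E]
    {u : E → ℝ} {x : E} (hx : x ∉ tsupport u) : ‖fderiv ℝ u x‖ₑ = 0 := by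
  rw [← ofReal_norm, fderiv_of_notMem_tsupport ℝ hx, norm_zero, ENNReal.ofReal_zero]

/-- A Leibniz bound for the derivative of a product with a cutoff function `b`. -/
theorem enorm_fderiv_mul_rpow_le {E : Type*} [NormedAddCommGroup E] [NormedSpace ℝ E]
    {b u : E → ℝ} {x : E} (hb : DifferentiableAt ℝ b x) (hu : DifferentiableAt ℝ u x) {M : ℝ≥0}
    (hb1 : ‖b x‖ₑ ≤ 1) (hM : ‖fderiv ℝ b x‖ₑ ≤ M) {q : ℝ} (hq : 1 ≤ q) :
    ‖fderiv ℝ (fun y => b y * u y) x‖ₑ ^ q ≤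
      2 ^ (q - 1) * (‖fderiv ℝ u x‖ₑ ^ q + (M : ℝ≥0∞) ^ q * ‖u x‖ₑ ^ q) := by
  have h0 : 0 ≤ q := by linarith
  rw [← ENNReal.mul_rpow_of_nonneg _ _ h0]
  refine le_trans ?_ (ENNReal.rpow_add_le_mul_rpow_add_rpow _ _ hq)
  gcongr
  rw [fderiv_fun_mul hb hu]
  refine (enorm_add_le (b x • fderiv ℝ u x) (u x • fderiv ℝ b x)).trans ?_
  rw [enorm_smul, enorm_smul, mul_comm ‖u x‖ₑ]
  gcongr
  exact mul_le_of_le_one_left zero_le hb1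

section VariableExponentPoincare

variable {n : ℕ} {Ω : Opens (EuclideanSpace ℝ (Fin n))}

/-! ### Raising the integrability exponent step by step -/

namespace VarExponent

/-- The truncated modular `∫ |u|^{min(p, s)}` over `S ∩ Ω` is bounded uniformly over the `C¹`
functions `u` with support in `Ω` whose gradient has modular at most one. -/
def TruncatedBound (p : VarExponent Ω) (s : ℝ) (S : Set (EuclideanSpace ℝ (Fin n))) : Prop :=
  ∃ C : ℝ≥0∞, C ≠ ∞ ∧ ∀ u : EuclideanSpace ℝ (Fin n) → ℝ, ContDiff ℝ 1 u → tsupport u ⊆ Ω →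
    ∫⁻ x in (Ω : Set (EuclideanSpace ℝ (Fin n))), ‖fderiv ℝ u x‖ₑ ^ p.toFun x ≤ 1 →
    ∫⁻ x in S ∩ Ω, ‖u x‖ₑ ^ min (p.toFun x) s ≤ C

variable (p : VarExponent Ω)

theorem truncatedBound_one (hn : 1 ≤ n)
    (hbdd : Bornology.IsBounded (Ω : Set (EuclideanSpace ℝ (Fin n)))) :
    p.TruncatedBound 1 (closure Ω) := by
  obtain ⟨C, hC, h⟩ := exists_eLpNorm_le_eLpNorm_fderiv hn hbdd (q := 1) (r := 1) le_rfl le_rfl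
    (by simp)
  refine ⟨C * (volume (Ω : Set (EuclideanSpace ℝ (Fin n))) + 1),
    ENNReal.mul_ne_top hC (ENNReal.add_ne_top.2 ⟨hbdd.measure_lt_top.ne, ENNReal.one_ne_top⟩),
    fun u hu hus hp => ?_⟩
  have h1 := h u hu hus
  simp only [ENNReal.coe_one, eLpNorm_one_eq_lintegral_enorm] at h1
  have hΩ := Ω.isOpen.measurableSet
  have hsupp : ∫⁻ x, ‖fderiv ℝ u x‖ₑ =
      ∫⁻ x in (Ω : Set (EuclideanSpace ℝ (Fin n))), ‖fderiv ℝ u x‖ₑ ^ (1 : ℝ) := by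
    rw [← lintegral_indicator hΩ]
    refine lintegral_congr fun x => ?_
    by_cases hx : x ∈ (Ω : Set (EuclideanSpace ℝ (Fin n)))
    · simp [indicator_of_mem hx]
    · rw [indicator_of_notMem hx, enorm_fderiv_of_notMem_tsupport fun h => hx (hus h)]
  calc ∫⁻ x in closure Ω ∩ Ω, ‖u x‖ₑ ^ min (p.toFun x) 1
      = ∫⁻ x in (Ω : Set (EuclideanSpace ℝ (Fin n))), ‖u x‖ₑ := by
        rw [inter_eq_self_of_subset_right subset_closure]
        refine setLIntegral_congr_fun hΩ fun x hx => ?_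
        simp only [min_eq_right (p.one_lt hx).le, ENNReal.rpow_one]
    _ ≤ ∫⁻ x, ‖u x‖ₑ := setLIntegral_le_lintegral _ _
    _ ≤ _ := by
        refine h1.trans ?_
        gcongr
        rw [hsupp]
        refine (setLIntegral_rpow_le_add hΩ (b := p.toFun) (fun _ _ => zero_le_one)
          fun x hx => (p.one_lt hx).le).trans ?_
        gcongr

/-- Locally, one application of the Sobolev inequality raises the truncation level by `1 / (2n)`:
near `x₀` the exponent oscillates so little that a single pair of constant exponents serves. -/
theorem truncatedBound_local (hn : 1 ≤ n)
    (hbdd : Bornology.IsBounded (Ω : Set (EuclideanSpace ℝ (Fin n)))) {s : ℝ} (hs : 1 ≤ s)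
    (h : p.TruncatedBound s (closure Ω)) {x₀ : EuclideanSpace ℝ (Fin n)}
    (hx₀ : x₀ ∈ closure (Ω : Set (EuclideanSpace ℝ (Fin n)))) :
    ∃ t ∈ 𝓝[closure Ω] x₀, p.TruncatedBound (s + 1 / (2 * n)) t := by
  have hn0 : (0 : ℝ) < n := by exact_mod_cast hn
  obtain ⟨δ, hδ⟩ : ∃ δ : ℝ, δ = 1 / (4 * n) := ⟨_, rfl⟩
  have hδ0 : 0 < δ := by rw [hδ]; positivity
  have hδ2 : 1 / (2 * (n : ℝ)) = 2 * δ := by rw [hδ]; field_simp; norm_num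
  obtain ⟨R, hR, hRp⟩ : ∃ R > 0, ∀ x ∈ Ω, x ∈ Metric.ball x₀ R → |p.toFun x - p.toFun x₀| < δ := by
    obtain ⟨R, hR, h⟩ := Metric.continuousWithinAt_iff.1 (p.continuousOn x₀ hx₀) δ hδ0
    exact ⟨R, hR, fun x hx hxR => h (subset_closure hx) hxR⟩
  -- `q` bounds `min (p, s)` from below near `x₀` and `r` bounds `min (p, s + 2δ)` from above.
  obtain ⟨q, hq⟩ : ∃ q : ℝ≥0, (q : ℝ) = max 1 (min (p.toFun x₀ - δ) s) :=
    ⟨⟨_, zero_le_one.trans (le_max_left _ _)⟩, rfl⟩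
  obtain ⟨r, hr⟩ : ∃ r : ℝ≥0, (r : ℝ) = q + 2 * δ := ⟨⟨q + 2 * δ, by positivity⟩, rfl⟩
  have hq1 : (1 : ℝ) ≤ q := by rw [hq]; exact le_max_left _ _
  have hqp : ∀ x ∈ Ω, x ∈ Metric.ball x₀ R → q ≤ min (p.toFun x) s := by
    intro x hx hxR
    have h1 := (abs_lt.1 (hRp x hx hxR)).1
    rw [hq]
    exact max_le (le_min (p.one_lt hx).le hs) (min_le_min (by linarith) le_rfl)
  have hpr : ∀ x ∈ Ω, x ∈ Metric.ball x₀ R → min (p.toFun x) (s + 1 / (2 * n)) ≤ r := by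
    intro x hx hxR
    have h1 := (abs_lt.1 (hRp x hx hxR)).2
    rw [hr, hq, hδ2]
    have h2 : min (p.toFun x) (s + 2 * δ) ≤ min (p.toFun x₀ - δ) s + 2 * δ := by
      rw [← min_add_add_right]
      exact min_le_min (by linarith) le_rfl
    exact h2.trans (add_le_add (le_max_right _ _) le_rfl)
  have hSob : (q : ℝ)⁻¹ - (n : ℝ)⁻¹ ≤ (r : ℝ)⁻¹ := by
    have hq0 : (0 : ℝ) < q := by linarith
    have hr0 : (0 : ℝ) < r := by linarith
    have h1 : (q : ℝ)⁻¹ - (r : ℝ)⁻¹ = (r - q) / (q * r) := by field_simp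
    have h2 : ((r : ℝ) - q) / (q * r) ≤ r - q :=
      div_le_self (by linarith) (one_le_mul_of_one_le_of_one_le hq1 (by linarith))
    have h3 : 2 * δ ≤ (n : ℝ)⁻¹ := by
      rw [← hδ2, ← one_div]
      exact one_div_le_one_div_of_le hn0 (by linarith)
    linarith
  obtain ⟨K, hK, hKu⟩ := exists_eLpNorm_le_eLpNorm_fderiv hn hbdd (q := q) (r := r)
    (by exact_mod_cast hq1) (by rw [← NNReal.coe_le_coe]; linarith) hSob
  obtain ⟨C, hC, hCu⟩ := h
  let b : ContDiffBump x₀ := ⟨R / 4, R / 2, by positivity, by linarith⟩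
  obtain ⟨M, hM⟩ : ∃ M : ℝ≥0, ∀ x, ‖fderiv ℝ b x‖ₑ ≤ M := by
    obtain ⟨M, hM⟩ := (b.hasCompactSupport.fderiv (𝕜 := ℝ)).exists_bound_of_continuous
      ((b.contDiff (n := 1)).continuous_fderiv one_ne_zero)
    refine ⟨M.toNNReal, fun x => ?_⟩
    rw [← ofReal_norm]
    exact ENNReal.ofReal_le_ofReal (hM x)
  set V := volume (Ω : Set (EuclideanSpace ℝ (Fin n))) with hV
  have hVt : V ≠ ∞ := hbdd.measure_lt_top.ne
  set G : ℝ≥0∞ := 2 ^ ((q : ℝ) - 1) * ((V + 1) + (M : ℝ≥0∞) ^ (q : ℝ) * (V + C)) with hG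
  have hMq : (M : ℝ≥0∞) ^ (q : ℝ) ≠ ∞ :=
    ENNReal.rpow_ne_top_of_nonneg (by positivity) ENNReal.coe_ne_top
  have h2q : (2 : ℝ≥0∞) ^ ((q : ℝ) - 1) ≠ ∞ :=
    ENNReal.rpow_ne_top_of_nonneg (by linarith) (by norm_num)
  have hGt : G ≠ ∞ := by
    refine ENNReal.mul_ne_top h2q (ENNReal.add_ne_top.2 ⟨?_, ENNReal.mul_ne_top hMq ?_⟩)
    · exact ENNReal.add_ne_top.2 ⟨hVt, ENNReal.one_ne_top⟩
    · exact ENNReal.add_ne_top.2 ⟨hVt, hC⟩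
  refine ⟨Metric.ball x₀ (R / 4),
    mem_nhdsWithin_of_mem_nhds (Metric.ball_mem_nhds _ (by positivity)),
    V + (K * G ^ (1 / (q : ℝ))) ^ (r : ℝ), ?_, fun u hu hus hup => ?_⟩
  · refine ENNReal.add_ne_top.2 ⟨hVt, ENNReal.rpow_ne_top_of_nonneg (by positivity) ?_⟩
    exact ENNReal.mul_ne_top hK (ENNReal.rpow_ne_top_of_nonneg (by positivity) hGt)
  have hΩ := Ω.isOpen.measurableSet
  have hA : MeasurableSet (Metric.ball x₀ R ∩ Ω) := measurableSet_ball.inter hΩ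
  have hA' : MeasurableSet (Metric.ball x₀ (R / 4) ∩ Ω) := measurableSet_ball.inter hΩ
  have hVA : volume (Metric.ball x₀ R ∩ Ω) ≤ V := measure_mono inter_subset_right
  have hv : ContDiff ℝ 1 fun x => b x * u x := b.contDiff.mul hu
  have hvs : tsupport (fun x => b x * u x) ⊆ Metric.ball x₀ R ∩ Ω := by
    refine subset_inter ?_ ((tsupport_mul_subset_right (f := b)).trans hus)
    refine (tsupport_mul_subset_left (f := b)).trans ?_
    rw [b.tsupport_eq]
    exact Metric.closedBall_subset_ball (by change R / 2 < R; linarith)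
  have hgrad : ∫⁻ x, ‖fderiv ℝ (fun x => b x * u x) x‖ₑ ^ (q : ℝ) ≤ G := by
    have hu1 : ∫⁻ x in Metric.ball x₀ R ∩ Ω, ‖fderiv ℝ u x‖ₑ ^ (q : ℝ) ≤ V + 1 := by
      refine (setLIntegral_rpow_le_add hA (b := p.toFun) (fun _ _ => by positivity)
        fun x hx => (hqp x hx.2 hx.1).trans (min_le_left _ _)).trans (add_le_add hVA ?_)
      exact (lintegral_mono_set inter_subset_right).trans hup
    have hu2 : ∫⁻ x in Metric.ball x₀ R ∩ Ω, ‖u x‖ₑ ^ (q : ℝ) ≤ V + C := by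
      refine (setLIntegral_rpow_le_add hA (b := fun x => min (p.toFun x) s)
        (fun _ _ => by positivity) fun x hx => hqp x hx.2 hx.1).trans (add_le_add hVA ?_)
      refine (lintegral_mono_set ?_).trans (hCu u hu hus hup)
      exact fun x hx => ⟨subset_closure hx.2, hx.2⟩
    have hmeas : Measurable fun x => ‖fderiv ℝ u x‖ₑ ^ (q : ℝ) :=
      ((hu.continuous_fderiv one_ne_zero).enorm.measurable).pow_const _
    calc ∫⁻ x, ‖fderiv ℝ (fun x => b x * u x) x‖ₑ ^ (q : ℝ)
        ≤ ∫⁻ x, (Metric.ball x₀ R ∩ Ω).indicator (fun x => 2 ^ ((q : ℝ) - 1) *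
            (‖fderiv ℝ u x‖ₑ ^ (q : ℝ) + (M : ℝ≥0∞) ^ (q : ℝ) * ‖u x‖ₑ ^ (q : ℝ))) x := by
          refine lintegral_mono fun x => ?_
          by_cases hx : x ∈ Metric.ball x₀ R ∩ Ω
          · rw [indicator_of_mem hx]
            refine enorm_fderiv_mul_rpow_le ((b.contDiff (n := 1)).differentiable one_ne_zero x)
              (hu.differentiable one_ne_zero x) ?_ (hM x) hq1
            rw [Real.enorm_of_nonneg b.nonneg, ENNReal.ofReal_le_one]
            exact b.le_one
          · rw [indicator_of_notMem hx, enorm_fderiv_of_notMem_tsupport fun h => hx (hvs h),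
              ENNReal.zero_rpow_of_pos (by linarith)]
      _ = 2 ^ ((q : ℝ) - 1) * ((∫⁻ x in Metric.ball x₀ R ∩ Ω, ‖fderiv ℝ u x‖ₑ ^ (q : ℝ)) +
            (M : ℝ≥0∞) ^ (q : ℝ) * ∫⁻ x in Metric.ball x₀ R ∩ Ω, ‖u x‖ₑ ^ (q : ℝ)) := by
          rw [lintegral_indicator hA, lintegral_const_mul' _ _ h2q, lintegral_add_left hmeas,
            lintegral_const_mul' _ _ hMq]
      _ ≤ G := by rw [hG]; gcongr
  have hvr : ∫⁻ x, ‖b x * u x‖ₑ ^ (r : ℝ) ≤ (K * G ^ (1 / (q : ℝ))) ^ (r : ℝ) := by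
    have hr0 : r ≠ 0 := by rw [← NNReal.coe_ne_zero]; linarith
    have hq0 : q ≠ 0 := by rw [← NNReal.coe_ne_zero]; linarith
    have h1 := hKu _ hv (hvs.trans inter_subset_right)
    rw [← eLpNorm_nnreal_pow_eq_lintegral hr0]
    gcongr
    refine h1.trans ?_
    rw [eLpNorm_nnreal_eq_lintegral hq0]
    gcongr
  have hsub : Metric.ball x₀ (R / 4) ⊆ Metric.ball x₀ R :=
    Metric.ball_subset_ball (by linarith)
  calc ∫⁻ x in Metric.ball x₀ (R / 4) ∩ Ω, ‖u x‖ₑ ^ min (p.toFun x) (s + 1 / (2 * n))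
      ≤ volume (Metric.ball x₀ (R / 4) ∩ Ω) +
        ∫⁻ x in Metric.ball x₀ (R / 4) ∩ Ω, ‖u x‖ₑ ^ (r : ℝ) := by
        refine setLIntegral_rpow_le_add hA' (fun x hx => ?_) fun x hx => hpr x hx.2 (hsub hx.1)
        exact le_min (by linarith [p.one_lt hx.2]) (by positivity)
    _ ≤ V + ∫⁻ x in Metric.ball x₀ (R / 4) ∩ Ω, ‖b x * u x‖ₑ ^ (r : ℝ) := by
        refine add_le_add (measure_mono inter_subset_right) (setLIntegral_mono' hA' fun x hx => ?_)
        rw [b.one_of_mem_closedBall (Metric.ball_subset_closedBall hx.1), one_mul]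
    _ ≤ _ := add_le_add le_rfl ((setLIntegral_le_lintegral _ _).trans hvr)

theorem truncatedBound_step (hn : 1 ≤ n)
    (hbdd : Bornology.IsBounded (Ω : Set (EuclideanSpace ℝ (Fin n)))) {s : ℝ} (hs : 1 ≤ s)
    (h : p.TruncatedBound s (closure Ω)) :
    p.TruncatedBound (s + 1 / (2 * n)) (closure Ω) := by
  refine hbdd.isCompact_closure.induction_on ?_ ?_ ?_
    fun x hx => p.truncatedBound_local hn hbdd hs h hx
  · exact ⟨0, ENNReal.zero_ne_top, by simp⟩
  · rintro S T hST ⟨C, hC, hT⟩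
    exact ⟨C, hC, fun u hu hus hup =>
      (lintegral_mono_set (inter_subset_inter_left _ hST)).trans (hT u hu hus hup)⟩
  · rintro S T ⟨C, hC, hS⟩ ⟨D, hD, hT⟩
    refine ⟨C + D, ENNReal.add_ne_top.2 ⟨hC, hD⟩, fun u hu hus hup => ?_⟩
    rw [union_inter_distrib_right]
    exact (lintegral_union_le _ _ _).trans (add_le_add (hS u hu hus hup) (hT u hu hus hup))

theorem exists_one_le_forall_le (hbdd : Bornology.IsBounded (Ω : Set (EuclideanSpace ℝ (Fin n)))) :
    ∃ P : ℝ, 1 ≤ P ∧ ∀ x ∈ Ω, p.toFun x ≤ P := by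
  obtain ⟨P, hP⟩ := hbdd.isCompact_closure.bddAbove_image p.continuousOn
  exact ⟨max 1 P, le_max_left _ _, fun x hx =>
    (hP (mem_image_of_mem _ (subset_closure hx))).trans (le_max_right _ _)⟩

/-- A Poincaré inequality in modular form, for functions whose gradient lies in the unit ball. Since
`p` is bounded, finitely many steps lift the truncation level above `p`. -/
theorem exists_modular_le (hn : 1 ≤ n)
    (hbdd : Bornology.IsBounded (Ω : Set (EuclideanSpace ℝ (Fin n)))) :
    ∃ C : ℝ≥0, ∀ u : EuclideanSpace ℝ (Fin n) → ℝ, ContDiff ℝ 1 u → tsupport u ⊆ Ω →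
      ∫⁻ x in (Ω : Set (EuclideanSpace ℝ (Fin n))), ‖fderiv ℝ u x‖ₑ ^ p.toFun x ≤ 1 →
      ∫⁻ x in (Ω : Set (EuclideanSpace ℝ (Fin n))), ‖u x‖ₑ ^ p.toFun x ≤ C := by
  have key : ∀ k : ℕ, p.TruncatedBound (1 + k * (1 / (2 * n))) (closure Ω) := by
    intro k
    induction k with
    | zero => simpa using p.truncatedBound_one hn hbdd
    | succ k ih =>
      have := p.truncatedBound_step hn hbdd (by simp; positivity) ih
      convert this using 1
      push_cast; ring
  obtain ⟨P, -, hP⟩ := p.exists_one_le_forall_le hbdd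
  have hn0 : (0 : ℝ) < n := by exact_mod_cast hn
  obtain ⟨k, hk⟩ := exists_nat_ge (P / (1 / (2 * (n : ℝ))))
  rw [div_le_iff₀ (by positivity)] at hk
  obtain ⟨C, hC, h⟩ := key k
  refine ⟨C.toNNReal, fun u hu hus hup => ?_⟩
  rw [ENNReal.coe_toNNReal hC]
  refine le_trans (le_of_eq ?_) (h u hu hus hup)
  rw [inter_eq_self_of_subset_right subset_closure]
  refine setLIntegral_congr_fun Ω.isOpen.measurableSet fun x hx => ?_
  simp only [min_eq_left ((hP x hx).trans (by linarith : P ≤ 1 + k * (1 / (2 * (n : ℝ)))))]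

end VarExponent

/-! ### Weak gradients of test functions -/

theorem continuous_gradient_of_contDiff {η : EuclideanSpace ℝ (Fin n) → ℝ}
    (hη : ContDiff ℝ 1 η) : Continuous (gradient η) :=
  (InnerProductSpace.toDual ℝ (EuclideanSpace ℝ (Fin n))).symm.continuous.comp
    (hη.continuous_fderiv one_ne_zero)

theorem gradient_apply_eq_fderiv_single (η : EuclideanSpace ℝ (Fin n) → ℝ)
    (x : EuclideanSpace ℝ (Fin n)) (i : Fin n) :
    gradient η x i = fderiv ℝ η x (EuclideanSpace.single i 1) := by
  rw [← inner_gradient_left, EuclideanSpace.inner_single_right]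
  simp

theorem setIntegral_mul_fderiv_eq_neg (η ξ : 𝓓(Ω, ℝ)) (w : EuclideanSpace ℝ (Fin n)) :
    ∫ x in (Ω : Set (EuclideanSpace ℝ (Fin n))), η x * fderiv ℝ ξ x w =
      - ∫ x in (Ω : Set (EuclideanSpace ℝ (Fin n))), fderiv ℝ η x w * ξ x := by
  obtain ⟨c1, k1, -⟩ := HasWeakGradient.deriv_props η w
  obtain ⟨c2, k2, s2⟩ := HasWeakGradient.deriv_props ξ w
  rw [setIntegral_eq_integral_of_forall_compl_eq_zero,
    setIntegral_eq_integral_of_forall_compl_eq_zero]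
  · refine integral_mul_fderiv_eq_neg_fderiv_mul_of_integrable ?_ ?_ ?_ ?_ ?_
    · exact (c1.mul ξ.continuous).integrable_of_hasCompactSupport k1.mul_right
    · exact (η.continuous.mul c2).integrable_of_hasCompactSupport k2.mul_left
    · exact (η.continuous.mul ξ.continuous).integrable_of_hasCompactSupport
        η.hasCompactSupport.mul_right
    · exact fun x _ => η.contDiff.differentiable (by simp) x
    · exact fun x _ => ξ.contDiff.differentiable (by simp) x
  · intro x hx
    rw [image_eq_zero_of_notMem_tsupport (fun h => hx (ξ.tsupport_subset h)), mul_zero]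
  · intro x hx
    rw [image_eq_zero_of_notMem_tsupport (fun h => hx (η.tsupport_subset h)), zero_mul]

/-- The classical gradient of a test function is its weak gradient. -/
theorem hasWeakGradient_mk_gradient (η : 𝓓(Ω, ℝ)) (u : MeasFun Ω ℝ)
    (hu : u =ᵐ[volume.restrict (Ω : Set (EuclideanSpace ℝ (Fin n)))] η) :
    HasWeakGradient u (AEEqFun.mk (gradient η) (continuous_gradient_of_contDiff
      (η.contDiff.of_le (by simp))).aestronglyMeasurable) := by
  have hc : Continuous (gradient η) :=
    continuous_gradient_of_contDiff (η.contDiff.of_le (by simp))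
  have hmk := AEEqFun.coeFn_mk (μ := volume.restrict (Ω : Set (EuclideanSpace ℝ (Fin n))))
    (gradient η) hc.aestronglyMeasurable
  refine ⟨locallyIntegrableOn_congr (η.continuous.locallyIntegrable.locallyIntegrableOn _) hu.symm,
    locallyIntegrableOn_congr (hc.locallyIntegrable.locallyIntegrableOn _) hmk.symm,
    fun ξ i => ?_⟩
  rw [integral_congr_ae (g := fun x => η x * fderiv ℝ ξ x (EuclideanSpace.single i 1)),
    setIntegral_mul_fderiv_eq_neg]
  · congr 1
    refine integral_congr_ae ?_
    filter_upwards [hmk] with x hx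
    rw [hx, gradient_apply_eq_fderiv_single]
  · filter_upwards [hu] with x hx
    rw [hx]

/-! ### Luxemburg norms and the Poincaré inequality -/

namespace ConvexModular

variable {X : Type*} [AddCommGroup X] [Module ℝ X] (ρ : ConvexModular X)

theorem luxemburgNorm_le {x : X} {a : ℝ} (ha : 0 < a) (h : ρ.toFun (a⁻¹ • x) ≤ 1) :
    ρ.luxemburgNorm x ≤ a :=
  csInf_le (ρ.bddBelow_lux x) ⟨ha, h⟩

/-- Convexity turns a modular bound `C ≥ 1` into a norm bound with the same constant. -/
theorem luxemburgNorm_le_mul {x : X} {a : ℝ} {C : ℝ≥0} (ha : 0 < a) (hC : 1 ≤ C)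
    (h : ρ.toFun (a⁻¹ • x) ≤ C) : ρ.luxemburgNorm x ≤ C * a := by
  have hC0 : (0 : ℝ) < C := by exact_mod_cast zero_lt_one.trans_le hC
  refine ρ.luxemburgNorm_le (by positivity) ?_
  have hinv : |(C : ℝ)⁻¹| = ((C⁻¹ : ℝ≥0) : ℝ) := by rw [abs_of_pos (by positivity)]; simp
  have h1 := ρ.map_smul_le (C : ℝ)⁻¹ (a⁻¹ • x)
    (by rw [hinv]; exact_mod_cast inv_le_one_of_one_le₀ hC)
  rw [smul_smul, ← mul_inv, hinv, ENNReal.ofReal_coe_nnreal] at h1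
  refine h1.trans ((mul_le_mul_right h _).trans (le_of_eq ?_))
  rw [← ENNReal.coe_mul, inv_mul_cancel₀ (by exact_mod_cast hC0.ne'), ENNReal.coe_one]

theorem exists_lt_of_luxemburgNorm_lt {x : X} (hx : x ∈ ρ.modularSpace) {b : ℝ}
    (h : ρ.luxemburgNorm x < b) : ∃ a, 0 < a ∧ ρ.toFun (a⁻¹ • x) ≤ 1 ∧ a < b := by
  obtain ⟨a, ⟨h1, h2⟩, h3⟩ := exists_lt_of_csInf_lt (ρ.nonempty_lux hx) h
  exact ⟨a, h1, h2, h3⟩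

end ConvexModular

namespace VarExponent

variable {p : VarExponent Ω}

theorem SobolevSpace.hasWeakGradient_grad (u : p.SobolevSpace) :
    HasWeakGradient u.toMeasFun u.grad :=
  SobolevSpace.choose_spec' u

theorem SobolevSpace.grad_mem (u : p.SobolevSpace) :
    u.grad ∈ p.lebesgueSpace (EuclideanSpace ℝ (Fin n)) :=
  u.exists_gradient.choose_spec.1

theorem enorm_grad_ae_eq_of_test {u : p.SobolevSpace} {η : 𝓓(Ω, ℝ)}
    (hu : u.toMeasFun =ᵐ[volume.restrict (Ω : Set (EuclideanSpace ℝ (Fin n)))] η) :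
    ∀ᵐ x ∂volume.restrict (Ω : Set (EuclideanSpace ℝ (Fin n))),
      ‖u.grad x‖ₑ = ‖fderiv ℝ η x‖ₑ := by
  rw [u.hasWeakGradient_grad.unique (hasWeakGradient_mk_gradient η _ hu)]
  filter_upwards [AEEqFun.coeFn_mk (μ := volume.restrict (Ω : Set (EuclideanSpace ℝ (Fin n))))
    (gradient η) (continuous_gradient_of_contDiff
      (η.contDiff.of_le (by simp))).aestronglyMeasurable] with x hx
  rw [hx, gradient, ← ofReal_norm, ← ofReal_norm, LinearIsometryEquiv.norm_map]

variable (p)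

/-- The Luxemburg norm of `∇u` in `L^{p(·)}(Ω; ℝⁿ)`; only a seminorm on `W^{1,p(·)}(Ω)`. -/
noncomputable def gradNorm (u : p.SobolevSpace) : ℝ :=
  (p.lebesgueModular (EuclideanSpace ℝ (Fin n))).luxemburgNorm u.grad

theorem gradNorm_add_le (u v : p.SobolevSpace) :
    p.gradNorm (u + v) ≤ p.gradNorm u + p.gradNorm v := by
  rw [gradNorm, map_add]
  exact ConvexModular.lux_add _ u.grad_mem v.grad_mem

theorem gradNorm_neg (u : p.SobolevSpace) : p.gradNorm (-u) = p.gradNorm u := by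
  have := (p.lebesgueModular (EuclideanSpace ℝ (Fin n))).lux_smul (-1) u.grad
  simpa [gradNorm] using this

theorem gradNorm_le_norm (u : p.SobolevSpace) : p.gradNorm u ≤ ‖u‖ := by
  refine le_of_forall_gt_imp_ge_of_dense fun b hb => ?_
  obtain ⟨a, ha, h, hab⟩ :=
    p.sobolevModular.exists_lt_of_luxemburgNorm_lt (p.mem_modularSpace u) hb
  refine (ConvexModular.luxemburgNorm_le _ ha ?_).trans hab.le
  rw [← map_smul]
  exact le_add_self.trans h

theorem exists_norm_le_gradNorm_of_test (hn : 1 ≤ n)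
    (hbdd : Bornology.IsBounded (Ω : Set (EuclideanSpace ℝ (Fin n)))) :
    ∃ K : ℝ, 0 ≤ K ∧ ∀ u ∈ p.testSubmodule, ‖u‖ ≤ K * p.gradNorm u := by
  obtain ⟨C, hC⟩ := p.exists_modular_le hn hbdd
  have bound : ∀ u ∈ p.testSubmodule,
      (p.lebesgueModular (EuclideanSpace ℝ (Fin n))).toFun u.grad ≤ 1 →
      p.sobolevModular.toFun u ≤ (C + 1 : ℝ≥0) := by
    rintro u ⟨η, hη⟩ hu
    have h1 := hC η (η.contDiff.of_le (by simp)) η.tsupport_subset (by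
      refine le_trans (le_of_eq (lintegral_congr_ae ?_)) hu
      filter_upwards [enorm_grad_ae_eq_of_test hη] with x hx
      rw [hx])
    rw [ENNReal.coe_add, ENNReal.coe_one]
    refine add_le_add (le_trans (le_of_eq (lintegral_congr_ae ?_)) h1) hu
    filter_upwards [hη] with x hx
    rw [hx]
  refine ⟨C + 1, by positivity, fun u hu => ?_⟩
  have hC1 : (0 : ℝ) < C + 1 := by positivity
  rw [mul_comm, ← div_le_iff₀ hC1]
  refine le_of_forall_gt_imp_ge_of_dense fun b hb => ?_
  obtain ⟨a, ha, h, hab⟩ := ConvexModular.exists_lt_of_luxemburgNorm_lt _ u.grad_mem hb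
  rw [div_le_iff₀ hC1]
  have h2 := p.sobolevModular.luxemburgNorm_le_mul (x := u) (C := C + 1) ha (by simp)
    (bound _ (p.testSubmodule.smul_mem a⁻¹ hu) (by rwa [map_smul]))
  refine le_trans (h2 : ‖u‖ ≤ _) ?_
  push_cast
  nlinarith

/-- The **Poincaré inequality** in `W_0^{1,p(·)}(Ω)`: it passes from test functions to their closure
because `gradNorm` is subadditive and dominated by the norm. -/
theorem exists_norm_le_gradNorm (hn : 1 ≤ n)
    (hbdd : Bornology.IsBounded (Ω : Set (EuclideanSpace ℝ (Fin n)))) :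
    ∃ K : ℝ, 0 ≤ K ∧ ∀ u ∈ p.sobolevZero, ‖u‖ ≤ K * p.gradNorm u := by
  obtain ⟨K, hK, h⟩ := p.exists_norm_le_gradNorm_of_test hn hbdd
  refine ⟨K, hK, fun u hu => le_of_forall_pos_le_add fun ε hε => ?_⟩
  obtain ⟨v, hv, huv⟩ := Metric.mem_closure_iff.1
    (show u ∈ closure (p.testSubmodule : Set p.SobolevSpace) from hu)
    (ε / (K + 1)) (by positivity)
  rw [dist_eq_norm, lt_div_iff₀ (by positivity)] at huv
  have h1 : ‖u‖ ≤ ‖u - v‖ + ‖v‖ := by simpa using norm_add_le (u - v) v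
  have h2 : p.gradNorm v ≤ p.gradNorm u + ‖u - v‖ := by
    have h3 := p.gradNorm_add_le u (-(u - v))
    rw [gradNorm_neg] at h3
    have h4 := p.gradNorm_le_norm (u - v)
    simp only [neg_sub, add_sub_cancel] at h3
    linarith
  have h5 := h v hv
  nlinarith [mul_le_mul_of_nonneg_left h2 hK]

/-! ### The modular and the Dirichlet integral -/

/-- Dividing by `t ≥ 1` shrinks the modular at least by the factor `t ^ p₋`. -/
theorem rpow_mul_lebesgueModular_le {V : Type*} [NormedAddCommGroup V] [NormedSpace ℝ V]
    {t : ℝ} (ht : 1 ≤ t) (v : MeasFun Ω V) :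
    ENNReal.ofReal (t ^ sInf (p.toFun '' (Ω : Set (EuclideanSpace ℝ (Fin n))))) *
      (p.lebesgueModular V).toFun (t⁻¹ • v) ≤ (p.lebesgueModular V).toFun v := by
  have ht0 : 0 < t := by linarith
  have hb : BddBelow (p.toFun '' (Ω : Set (EuclideanSpace ℝ (Fin n)))) :=
    ⟨1, by rintro _ ⟨x, hx, rfl⟩; exact (p.one_lt hx).le⟩
  simp only [lebesgueModular]
  rw [← lintegral_const_mul' _ _ ENNReal.ofReal_ne_top]
  refine lintegral_mono_ae ?_
  filter_upwards [AEEqFun.coeFn_smul t⁻¹ v, ae_restrict_mem Ω.isOpen.measurableSet] with x hx hxΩ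
  have hp0 : 0 ≤ p.toFun x := by linarith [p.one_lt hxΩ]
  have h1 : ‖v x‖ₑ = ENNReal.ofReal t * ‖(t⁻¹ • v : MeasFun Ω V) x‖ₑ := by
    rw [hx, Pi.smul_apply, enorm_smul, ← mul_assoc, Real.enorm_of_nonneg (by positivity),
      ← ENNReal.ofReal_mul ht0.le, mul_inv_cancel₀ ht0.ne', ENNReal.ofReal_one, one_mul]
  rw [h1, ENNReal.mul_rpow_of_nonneg _ _ hp0, ENNReal.ofReal_rpow_of_pos ht0]
  gcongr
  exact csInf_le hb (mem_image_of_mem _ hxΩ)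

/-- As the exponent is bounded, the modular is finite on all of `L^{p(·)}`, not merely on small
multiples of each element. -/
theorem lebesgueModular_lt_top
    (hbdd : Bornology.IsBounded (Ω : Set (EuclideanSpace ℝ (Fin n))))
    {V : Type*} [NormedAddCommGroup V] [NormedSpace ℝ V] {v : MeasFun Ω V}
    (hv : v ∈ p.lebesgueSpace V) : (p.lebesgueModular V).toFun v < ∞ := by
  obtain ⟨P, hP1, hP⟩ := p.exists_one_le_forall_le hbdd
  obtain ⟨a, ha, h⟩ := (p.lebesgueModular V).nonempty_lux hv
  set c : ℝ≥0∞ := ENNReal.ofReal a + 1 with hc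
  have hct : c ^ P ≠ ∞ :=
    ENNReal.rpow_ne_top_of_nonneg (by linarith) (by simp [hc])
  refine lt_of_le_of_lt (b := c ^ P * (p.lebesgueModular V).toFun (a⁻¹ • v)) ?_
    (ENNReal.mul_lt_top hct.lt_top (h.trans_lt ENNReal.one_lt_top))
  simp only [lebesgueModular]
  rw [← lintegral_const_mul' _ _ hct]
  refine lintegral_mono_ae ?_
  filter_upwards [AEEqFun.coeFn_smul a⁻¹ v, ae_restrict_mem Ω.isOpen.measurableSet] with x hx hxΩ
  have hp0 : 0 ≤ p.toFun x := by linarith [p.one_lt hxΩ]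
  have h1 : ‖v x‖ₑ ≤ c * ‖(a⁻¹ • v : MeasFun Ω V) x‖ₑ := by
    rw [hx, Pi.smul_apply, enorm_smul, ← mul_assoc, Real.enorm_of_nonneg (by positivity)]
    refine le_mul_of_one_le_left zero_le ?_
    calc (1 : ℝ≥0∞) = ENNReal.ofReal a * ENNReal.ofReal a⁻¹ := by
          rw [← ENNReal.ofReal_mul ha.le, mul_inv_cancel₀ ha.ne', ENNReal.ofReal_one]
      _ ≤ _ := by gcongr; exact le_self_add
  refine (ENNReal.rpow_le_rpow h1 hp0).trans ?_
  rw [ENNReal.mul_rpow_of_nonneg _ _ hp0]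
  gcongr
  · exact le_add_self
  · exact hP x hxΩ

theorem aemeasurable_dirichletIntegrand (w : p.SobolevSpace) :
    AEMeasurable (dirichletIntegrand w)
      (volume.restrict (Ω : Set (EuclideanSpace ℝ (Fin n)))) :=
  (w.grad.aestronglyMeasurable.norm.aemeasurable.pow p.aemeasurable).div p.aemeasurable

theorem ofReal_dirichletIntegrand (w : p.SobolevSpace) {x : EuclideanSpace ℝ (Fin n)}
    (hx : x ∈ Ω) : ENNReal.ofReal (dirichletIntegrand w x) =
      ‖w.grad x‖ₑ ^ p.toFun x / ENNReal.ofReal (p.toFun x) := by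
  have hp0 : 0 < p.toFun x := by linarith [p.one_lt hx]
  rw [dirichletIntegrand, ENNReal.ofReal_div_of_pos hp0,
    ← ENNReal.ofReal_rpow_of_nonneg (norm_nonneg _) hp0.le, ofReal_norm]

theorem dirichletIntegrand_nonneg (w : p.SobolevSpace) {x : EuclideanSpace ℝ (Fin n)}
    (hx : x ∈ Ω) : 0 ≤ dirichletIntegrand w x := by
  have hp0 : 0 < p.toFun x := by linarith [p.one_lt hx]
  unfold dirichletIntegrand
  positivity

theorem lintegral_dirichletIntegrand_le (w : p.SobolevSpace) :
    ∫⁻ x in (Ω : Set (EuclideanSpace ℝ (Fin n))), ENNReal.ofReal (dirichletIntegrand w x) ≤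
      (p.lebesgueModular (EuclideanSpace ℝ (Fin n))).toFun w.grad := by
  refine setLIntegral_mono' Ω.isOpen.measurableSet fun x hx => ?_
  rw [ofReal_dirichletIntegrand p w hx]
  refine ENNReal.div_le_of_le_mul (le_mul_of_one_le_right zero_le ?_)
  exact ENNReal.one_le_ofReal.2 (p.one_lt hx).le

theorem integrableOn_dirichletIntegrand
    (hbdd : Bornology.IsBounded (Ω : Set (EuclideanSpace ℝ (Fin n)))) (w : p.SobolevSpace) :
    IntegrableOn (dirichletIntegrand w) (Ω : Set (EuclideanSpace ℝ (Fin n))) := by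
  refine ⟨(p.aemeasurable_dirichletIntegrand w).aestronglyMeasurable, ?_⟩
  rw [hasFiniteIntegral_iff_ofReal]
  · exact (p.lintegral_dirichletIntegrand_le w).trans_lt (p.lebesgueModular_lt_top hbdd w.grad_mem)
  · exact (ae_restrict_iff' Ω.isOpen.measurableSet).2
      (ae_of_all _ fun x hx => dirichletIntegrand_nonneg p w hx)

theorem setIntegral_dirichletIntegrand_nonneg (w : p.SobolevSpace) :
    0 ≤ ∫ x in (Ω : Set (EuclideanSpace ℝ (Fin n))), dirichletIntegrand w x :=
  setIntegral_nonneg Ω.isOpen.measurableSet fun _ hx => dirichletIntegrand_nonneg p w hx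

theorem rpow_div_le_setIntegral_dirichletIntegrand
    (hbdd : Bornology.IsBounded (Ω : Set (EuclideanSpace ℝ (Fin n)))) {P : ℝ} (hP1 : 1 ≤ P)
    (hP : ∀ x ∈ Ω, p.toFun x ≤ P) (w : p.SobolevSpace) {t : ℝ} (ht : 1 ≤ t)
    (htw : t < p.gradNorm w) :
    t ^ sInf (p.toFun '' (Ω : Set (EuclideanSpace ℝ (Fin n)))) / P ≤
      ∫ x in (Ω : Set (EuclideanSpace ℝ (Fin n))), dirichletIntegrand w x := by
  have ht0 : 0 < t := by linarith
  have hP0 : 0 < P := by linarith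
  set m := sInf (p.toFun '' (Ω : Set (EuclideanSpace ℝ (Fin n))))
  have h1 : 1 ≤ (p.lebesgueModular (EuclideanSpace ℝ (Fin n))).toFun (t⁻¹ • w.grad) := by
    by_contra! h
    exact htw.not_ge (ConvexModular.luxemburgNorm_le _ ht0 h.le)
  have h2 : ENNReal.ofReal (t ^ m) ≤
      (p.lebesgueModular (EuclideanSpace ℝ (Fin n))).toFun w.grad :=
    (le_mul_of_one_le_right zero_le h1).trans (p.rpow_mul_lebesgueModular_le ht w.grad)
  have h3 : (p.lebesgueModular (EuclideanSpace ℝ (Fin n))).toFun w.grad ≤ ENNReal.ofReal P *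
      ∫⁻ x in (Ω : Set (EuclideanSpace ℝ (Fin n))), ENNReal.ofReal (dirichletIntegrand w x) := by
    rw [← lintegral_const_mul' _ _ ENNReal.ofReal_ne_top]
    refine setLIntegral_mono' Ω.isOpen.measurableSet fun x hx => ?_
    have hp0 : 0 < p.toFun x := by linarith [p.one_lt hx]
    rw [ofReal_dirichletIntegrand p w hx]
    calc ‖w.grad x‖ₑ ^ p.toFun x = ENNReal.ofReal (p.toFun x) *
          (‖w.grad x‖ₑ ^ p.toFun x / ENNReal.ofReal (p.toFun x)) :=
          (ENNReal.mul_div_cancel (ENNReal.ofReal_pos.2 hp0).ne' ENNReal.ofReal_ne_top).symm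
      _ ≤ _ := by gcongr; exact hP x hx
  rw [← ofReal_integral_eq_lintegral_ofReal (p.integrableOn_dirichletIntegrand hbdd w)
    ((ae_restrict_iff' Ω.isOpen.measurableSet).2
      (ae_of_all _ fun x hx => dirichletIntegrand_nonneg p w hx)),
    ← ENNReal.ofReal_mul hP0.le] at h3
  rw [div_le_iff₀' hP0]
  exact (ENNReal.ofReal_le_ofReal_iff
    (mul_nonneg hP0.le (p.setIntegral_dirichletIntegrand_nonneg w))).1 (h2.trans h3)

/-- The Dirichlet integral grows faster than any linear function of `gradNorm`, because
`p₋ > 1`. -/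
theorem exists_mul_gradNorm_le
    (hbdd : Bornology.IsBounded (Ω : Set (EuclideanSpace ℝ (Fin n)))) {L : ℝ} (hL : 0 ≤ L) :
    ∃ T : ℝ, ∀ w : p.SobolevSpace, L * (p.gradNorm w - T) ≤
      ∫ x in (Ω : Set (EuclideanSpace ℝ (Fin n))), dirichletIntegrand w x := by
  obtain ⟨P, hP1, hP⟩ := p.exists_one_le_forall_le hbdd
  have hP0 : 0 < P := by linarith
  set m := sInf (p.toFun '' (Ω : Set (EuclideanSpace ℝ (Fin n)))) with hm
  have hm1 : 0 < m - 1 := by linarith [p.one_lt_sInf]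
  obtain ⟨T, hT1, hT⟩ : ∃ T : ℝ, 1 ≤ T ∧ ∀ t ≥ T, L * P ≤ t ^ (m - 1) := by
    obtain ⟨T, hT⟩ := ((tendsto_rpow_atTop hm1).eventually_ge_atTop (L * P)).exists_forall_of_atTop
    exact ⟨max 1 T, le_max_left _ _, fun t ht => hT t ((le_max_right _ _).trans ht)⟩
  refine ⟨T, fun w => ?_⟩
  have h0 := p.setIntegral_dirichletIntegrand_nonneg w
  rcases le_or_gt (p.gradNorm w) T with h | h
  · exact (mul_nonpos_of_nonneg_of_nonpos hL (by linarith)).trans h0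
  · -- The modular of `∇w / t` is known to be at least one only for `t` strictly below the norm,
    -- so the estimate is proved for such `t` and then `t` tends to the norm.
    have key : ∀ t ∈ Ioo T (p.gradNorm w), L * t ≤
        ∫ x in (Ω : Set (EuclideanSpace ℝ (Fin n))), dirichletIntegrand w x := by
      intro t ⟨ht, htw⟩
      have ht0 : 0 < t := by linarith
      refine le_trans ?_ (p.rpow_div_le_setIntegral_dirichletIntegrand hbdd hP1 hP w
        (by linarith) htw)
      rw [le_div_iff₀ hP0, ← hm, ← sub_add_cancel m 1, Real.rpow_add_one ht0.ne']
      nlinarith [hT t ht.le]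
    have h1 : L * p.gradNorm w ≤
        ∫ x in (Ω : Set (EuclideanSpace ℝ (Fin n))), dirichletIntegrand w x := by
      refine le_of_tendsto (f := fun t => L * t) (x := 𝓝[<] (p.gradNorm w)) ?_
        (eventually_of_mem (Ioo_mem_nhdsLT h) key)
      exact ((continuous_const.mul continuous_id).tendsto _).mono_left nhdsWithin_le_nhds
    nlinarith

end VarExponent

end VariableExponentPoincare

theorem theorem4p1 {n : ℕ} (hn : 1 ≤ n) (Ω : Opens (EuclideanSpace ℝ (Fin n)))
    (hΩ : IsConnected (Ω : Set (EuclideanSpace ℝ (Fin n))))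
    (hbdd : Bornology.IsBounded (Ω : Set (EuclideanSpace ℝ (Fin n))))
    (α : ℝ≥0) (hα0 : 0 < α) (hα1 : α ≤ 1)
    (hreg : HasC1HolderBoundary α (Ω : Set (EuclideanSpace ℝ (Fin n))))
    (p : VarExponent Ω) (f : StrongDual ℝ ↥p.sobolevZero) (φ : p.SobolevSpace) :
    (∀ u : ↥p.sobolevZero,
      IntegrableOn (VarExponent.dirichletIntegrand (φ - (u : p.SobolevSpace)))
        (Ω : Set (EuclideanSpace ℝ (Fin n)))) ∧
      BddBelow (range (VarExponent.energy φ f)) := by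
  refine ⟨fun u => p.integrableOn_dirichletIntegrand hbdd _, ?_⟩
  obtain ⟨K, hK, hP⟩ := p.exists_norm_le_gradNorm hn hbdd
  obtain ⟨T, hT⟩ := p.exists_mul_gradNorm_le hbdd (L := ‖f‖ * K) (by positivity)
  refine ⟨-(‖f‖ * K * (p.gradNorm φ + T)), ?_⟩
  rintro _ ⟨u, rfl⟩
  have h1 := hT (φ - u)
  have h2 : f u ≤ ‖f‖ * K * (p.gradNorm φ + p.gradNorm (φ - u)) := by
    have h3 := p.gradNorm_add_le φ (-(φ - u))
    rw [VarExponent.gradNorm_neg] at h3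
    simp only [neg_sub, add_sub_cancel] at h3
    calc f u ≤ ‖f‖ * ‖u‖ := (le_abs_self _).trans (f.le_opNorm u)
      _ ≤ ‖f‖ * (K * p.gradNorm u) := by gcongr; exact hP u u.2
      _ ≤ ‖f‖ * (K * (p.gradNorm φ + p.gradNorm (φ - u))) := by gcongr
      _ = _ := by ring
  unfold VarExponent.energy
  linarith
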